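/- Let $\rho$ be a probability measure on $\mathbb{R}^d$ (for instance given by a density on an input domain), let $\omega_1,\dots,\omega_N\in\mathbb{R}$, let $W_1,\dots,W_N\in\mathbb{R}^{d\times r}$ have orthonormal columns, and let $g_1,\dots,g_N:\mathbb{R}^r\to\mathbb{R}$ be such that, for each $i$, $g_i$ is differentiable at $W_i^T x$ for $\rho$-almost every $x$. Put $$h(x)=\sum_{i=1}^N\omega_i\, g_i(W_i^Tx),\qquad C(h)=\mathbb{E}\big[\nabla h(x)\nabla h(x)^T\big],\quad x\sim\rho,$$ and write $\nabla g_i$ for the random vector $\nabla g_i(W_i^Tx)\in\mathbb{R}^r$, $x\sim\rho$. Let $x^{(1)},\dots,x^{(M)}$ be independent random inputs with law $\rho$, and let $\widehat W_1,\dots,\widehat W_N$ be random matrices in $\mathbb{R}^{d\times r}$ with orthonormal columns almost surely (they may depend on the sample). Define $$\widehat C(h)=\frac1M\sum_{m=1}^M\widehat J_m\,\omega\omega^T\,\widehat J_m^{\,T},\qquad \widehat J_m=\Big[\widehat W_1\nabla g_1(W_1^Tx^{(m)}),\dots,\widehat W_N\nabla g_N(W_N^Tx^{(m)})\Big]\in\mathbb{R}^{d\times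 N}.$$ Let $\|\cdot\|_2$ denote the Euclidean norm of vectors and the spectral norm of matrices. Let $L,\eta_M\in\mathbb{R}$ and $\epsilon>0$, and suppose that for all $1\le i,j\le N$, almost surely, $$\|\nabla g_i\|_2\le L,\qquad \|\widehat W_i-W_i\|_2\le\eta_M,\qquad M\ \ge\ \frac{2L^2\log(2r)}{\epsilon^2\,\big\|\mathbb{E}[\nabla g_i\nabla g_j^T]\big\|_2},$$ where the last condition is understood as $M\epsilon^2\|\mathbb{E}[\nabla g_i\nabla g_j^T]\|_2\ge 2L^2\log(2r)$ (and, if $r=0$, as no condition). Then $\|\widehat C(h)-C(h)\|_2$ is integrable and $$\mathbb{E}\big\|\widehat C(h)-C(h)\big\|_2\ \le\ L^2\,C\,\big(2\eta_M+\epsilon+\epsilon^2\big),\qquad C=\sum_{i,j=1}^N|\omega_i\omega_j|.$$ In particular the required $M$ depends on the nodal ridge dimension $r$ and not explicitly on the input dimension $d$. -/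

import Mathlib

open MeasureTheory ProbabilityTheory
open scoped Matrix Matrix.Norms.L2Operator

/- The scoped instances opened above make `‖A‖`, for a real matrix `A`, the spectral norm, that is
the operator norm between Euclidean spaces (the largest singular value of `A`). -/

namespace EmbeddedRidge

variable {d r N M : ℕ}

/-- The reduced coordinates `Wᵀ x` of an input `x`. -/
noncomputable def proj (W : Matrix (Fin d) (Fin r) ℝ) (x : EuclideanSpace ℝ (Fin d)) :
    EuclideanSpace ℝ (Fin r) :=
  WithLp.toLp 2 (Wᵀ *ᵥ x.ofLp)

/-- The embedded ridge function: component `i` is the ridge function `x ↦ g i ((W i)ᵀ x)`. -/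
noncomputable def field (W : Fin N → Matrix (Fin d) (Fin r) ℝ)
    (g : Fin N → EuclideanSpace ℝ (Fin r) → ℝ) (x : EuclideanSpace ℝ (Fin d)) (i : Fin N) : ℝ :=
  g i (proj (W i) x)

/-- The quantity of interest `h = ωᵀ f`, a weighted sum of the nodal ridge functions. -/
noncomputable def qoi (ω : Fin N → ℝ) (W : Fin N → Matrix (Fin d) (Fin r) ℝ)
    (g : Fin N → EuclideanSpace ℝ (Fin r) → ℝ) (x : EuclideanSpace ℝ (Fin d)) : ℝ :=
  ∑ i, ω i * field W g x i

/-- The nodal gradient `∇ g (Wᵀ x)`: the gradient of the profile `g` with respect to the reduced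
coordinates, evaluated at `Wᵀ x`. -/
noncomputable def nodalGrad (W : Matrix (Fin d) (Fin r) ℝ) (g : EuclideanSpace ℝ (Fin r) → ℝ)
    (x : EuclideanSpace ℝ (Fin d)) : EuclideanSpace ℝ (Fin r) :=
  gradient g (proj W x)

/-- The matrix `E[u vᵀ]` of expectations, entry by entry, under the law `ρ`. -/
noncomputable def expOuter (ρ : Measure (EuclideanSpace ℝ (Fin d))) {k : ℕ}
    (u v : EuclideanSpace ℝ (Fin d) → EuclideanSpace ℝ (Fin k)) : Matrix (Fin k) (Fin k) ℝ :=
  Matrix.of fun a b => ∫ x, u x a * v x b ∂ρ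

/-- The gradient covariance matrix `C(h) = E[∇h ∇hᵀ]`. -/
noncomputable def gradCov (ρ : Measure (EuclideanSpace ℝ (Fin d)))
    (h : EuclideanSpace ℝ (Fin d) → ℝ) : Matrix (Fin d) (Fin d) ℝ :=
  expOuter ρ (gradient h) (gradient h)

/-- The estimated Jacobian at the input `x`: its `i`-th column is `Ŵ i ∇ g i ((W i)ᵀ x)`, that is,
the nodal gradient lifted to the input space by the estimated ridge basis `Ŵ i`. -/
noncomputable def jacobianEst (What W : Fin N → Matrix (Fin d) (Fin r) ℝ)
    (g : Fin N → EuclideanSpace ℝ (Fin r) → ℝ) (x : EuclideanSpace ℝ (Fin d)) :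
    Matrix (Fin d) (Fin N) ℝ :=
  Matrix.of fun a i => (What i *ᵥ (nodalGrad (W i) (g i) x).ofLp) a

/-- The Monte Carlo estimate `Ĉ(h) = M⁻¹ ∑ₘ Ĵ(xₘ) R Ĵ(xₘ)ᵀ` with `R = ω ωᵀ`. -/
noncomputable def gradCovEst (ω : Fin N → ℝ) (What W : Fin N → Matrix (Fin d) (Fin r) ℝ)
    (g : Fin N → EuclideanSpace ℝ (Fin r) → ℝ) (xs : Fin M → EuclideanSpace ℝ (Fin d)) :
    Matrix (Fin d) (Fin d) ℝ :=
  (M : ℝ)⁻¹ • ∑ m, jacobianEst What W g (xs m) * Matrix.vecMulVec ω ω *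
    (jacobianEst What W g (xs m))ᵀ

end EmbeddedRidge

/-!
Write `u i` for the nodal gradient `∇ g i ((W i)ᵀ x)`. The chain rule gives `∇h = ∑ i, ω i W i (u i)`
almost surely, so that
`C(h) = ∑ i j, ω i ω j W i E[u i (u j)ᵀ] (W j)ᵀ`, and the estimate `Ĉ(h)` has the same form with
`Ŵ` in place of `W` and sample means `Ê i j` in place of the expectations
(`gradCov_qoi_eq_sum`, `gradCovEst_eq_sum`). Since all bases have spectral norm at most one,
replacing the two bases in one summand costs at most `2 η ‖Ê i j‖ ≤ 2 η L²`, and what remains is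
`‖Ê i j - E[u i (u j)ᵀ]‖` (`norm_conj_sub_conj_le`). This holds pointwise, whatever the dependence of
`Ŵ` on the sample.

The sampling error needs no matrix concentration inequality. The summands of `Ê i j` have rank one,
so their Frobenius norm equals their spectral norm `‖u i‖ ‖u j‖ ≤ L²`. The variances of the entries
therefore add up to at most `L⁴ / M`, without a dimensional factor, and
`E ‖Ê i j - E[u i (u j)ᵀ]‖ ≤ L² / √M` (`integral_norm_empOuter_sub_le`). As
`‖E[u i (u j)ᵀ]‖ ≤ L²` and `2 log (2 r) ≥ 2 log 2 ≥ 1` for `r ≥ 1`, the condition on `M` gives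
`M ε² ≥ 1` unless `L = 0` or `r = 0`, and the sampling error is at most `L² ε`
(`integral_norm_empOuter_sub_le_of_log_le`). The term `ε²` of the bound is slack.
-/

namespace EmbeddedRidge

variable {d r N M : ℕ}

/-! ### Spectral norm estimates -/

/-- The spectral norm is at most the Frobenius norm. -/
theorem norm_sq_le_sum_sq {m n : ℕ} (A : Matrix (Fin m) (Fin n) ℝ) :
    ‖A‖ ^ 2 ≤ ∑ a, ∑ b, A a b ^ 2 := by
  have hS : 0 ≤ ∑ a, ∑ b, A a b ^ 2 := by positivity
  refine Real.le_sqrt (norm_nonneg _) hS |>.1 ?_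
  rw [Matrix.l2_opNorm_def]
  refine ContinuousLinearMap.opNorm_le_bound _ (Real.sqrt_nonneg _) fun x => ?_
  refine (sq_le_sq₀ (norm_nonneg _) (by positivity)).1 ?_
  rw [mul_pow, Real.sq_sqrt hS, EuclideanSpace.norm_sq_eq, EuclideanSpace.norm_sq_eq,
    Finset.sum_mul]
  refine Finset.sum_le_sum fun a _ => ?_
  simp only [Real.norm_eq_abs, sq_abs]
  exact Finset.sum_mul_sq_le_sq_mul_sq Finset.univ (A a) x.ofLp

theorem norm_vecMulVec_le {m n : ℕ} (u : EuclideanSpace ℝ (Fin m))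
    (v : EuclideanSpace ℝ (Fin n)) : ‖Matrix.vecMulVec u.ofLp v.ofLp‖ ≤ ‖u‖ * ‖v‖ := by
  refine (sq_le_sq₀ (norm_nonneg _) (by positivity)).1 ((norm_sq_le_sum_sq _).trans_eq ?_)
  rw [mul_pow, EuclideanSpace.real_norm_sq_eq, EuclideanSpace.real_norm_sq_eq,
    Finset.sum_mul_sum]
  simp [Matrix.vecMulVec_apply, mul_pow]

theorem norm_transpose {m n : ℕ} (A : Matrix (Fin m) (Fin n) ℝ) : ‖Aᵀ‖ = ‖A‖ := by
  rw [← Matrix.conjTranspose_eq_transpose_of_trivial, Matrix.l2_opNorm_conjTranspose]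

theorem norm_le_one_of_transpose_mul_self {m n : ℕ} {A : Matrix (Fin m) (Fin n) ℝ}
    (hA : Aᵀ * A = 1) : ‖A‖ ≤ 1 := by
  have h := Matrix.l2_opNorm_conjTranspose_mul_self A
  have h1 : ‖(1 : Matrix (Fin n) (Fin n) ℝ)‖ ≤ 1 := by
    rw [← Matrix.diagonal_one, Matrix.l2_opNorm_diagonal]
    exact (pi_norm_le_iff_of_nonneg zero_le_one).2 fun i => by simp
  rw [Matrix.conjTranspose_eq_transpose_of_trivial, hA] at h
  nlinarith [norm_nonneg A]

theorem norm_mul_mul_transpose_le {m n : ℕ} (A B : Matrix (Fin m) (Fin n) ℝ)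
    (S : Matrix (Fin n) (Fin n) ℝ) : ‖A * S * Bᵀ‖ ≤ ‖A‖ * ‖S‖ * ‖B‖ := by
  refine (Matrix.l2_opNorm_mul _ _).trans ?_
  rw [norm_transpose]
  gcongr
  exact Matrix.l2_opNorm_mul _ _

/-- Perturbation of both bases and of the core of a product `A T Bᵀ`. By telescoping, each exchanged
basis costs `η K`; only `S`, the core that goes with the perturbed bases, has to be bounded. -/
theorem norm_conj_sub_conj_le {m n : ℕ} {A A' B B' : Matrix (Fin m) (Fin n) ℝ}
    (S T : Matrix (Fin n) (Fin n) ℝ) {η K : ℝ} (hA : ‖A‖ ≤ 1) (hB : ‖B‖ ≤ 1)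
    (hB' : ‖B'‖ ≤ 1) (hAA' : ‖A' - A‖ ≤ η) (hBB' : ‖B' - B‖ ≤ η)
    (hS : ‖S‖ ≤ K) : ‖A' * S * B'ᵀ - A * T * Bᵀ‖ ≤ 2 * η * K + ‖S - T‖ := by
  have hη : 0 ≤ η := (norm_nonneg _).trans hAA'
  have hK : 0 ≤ K := (norm_nonneg _).trans hS
  have key : A' * S * B'ᵀ - A * T * Bᵀ =
      (A' - A) * S * B'ᵀ + A * S * (B' - B)ᵀ + A * (S - T) * Bᵀ := by
    simp only [Matrix.sub_mul, Matrix.mul_sub, Matrix.transpose_sub]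
    abel
  have h1 : ‖(A' - A) * S * B'ᵀ‖ ≤ η * K * 1 :=
    (norm_mul_mul_transpose_le _ _ _).trans (by gcongr)
  have h2 : ‖A * S * (B' - B)ᵀ‖ ≤ 1 * K * η :=
    (norm_mul_mul_transpose_le _ _ _).trans (by gcongr)
  have h3 : ‖A * (S - T) * Bᵀ‖ ≤ 1 * ‖S - T‖ * 1 :=
    (norm_mul_mul_transpose_le _ _ _).trans (by gcongr)
  rw [key]
  linarith [norm_add₃_le (a := (A' - A) * S * B'ᵀ) (b := A * S * (B' - B)ᵀ)
    (c := A * (S - T) * Bᵀ)]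

/-! ### Variance of a sample mean -/

/-- The mean squared error of a sample mean of `M` independent copies is the variance divided by `M`,
bounded here by the second moment. -/
theorem integral_sq_sampleMean_sub_le {α Ω : Type*} [MeasurableSpace α] [MeasurableSpace Ω]
    {ρ : Measure α} [IsProbabilityMeasure ρ] {P : Measure Ω} [IsProbabilityMeasure P]
    {X : Fin M → Ω → α} (hXlaw : ∀ m, HasLaw (X m) ρ P) (hXindep : iIndepFun X P)
    (hM : 0 < M) {f : α → ℝ} (hf : Measurable f) (hf2 : MemLp f 2 ρ) :
    Integrable (fun z => ((M : ℝ)⁻¹ * ∑ m, f (X m z) - ∫ x, f x ∂ρ) ^ 2) P ∧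
    ∫ z, ((M : ℝ)⁻¹ * ∑ m, f (X m z) - ∫ x, f x ∂ρ) ^ 2 ∂P ≤ (M : ℝ)⁻¹ * ∫ x, f x ^ 2 ∂ρ := by
  have hM' : (M : ℝ) ≠ 0 := by positivity
  have hmem : ∀ m, MemLp (fun z => f (X m z)) 2 P := fun m =>
    MemLp.comp_of_map (by rw [(hXlaw m).map_eq]; exact hf2) (hXlaw m).aemeasurable
  have hint : ∀ m, ∫ z, f (X m z) ∂P = ∫ x, f x ∂ρ := fun m =>
    (hXlaw m).integral_comp hf.aestronglyMeasurable
  have hmean : ∫ z, (M : ℝ)⁻¹ * ∑ m, f (X m z) ∂P = ∫ x, f x ∂ρ := by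
    rw [integral_const_mul, integral_finsetSum _ fun m _ => (hmem m).integrable one_le_two]
    simp [hint, hM']
  have hmemS : MemLp (fun z => (M : ℝ)⁻¹ * ∑ m, f (X m z)) 2 P :=
    (memLp_finsetSum _ fun m _ => hmem m).const_mul _
  refine ⟨(hmemS.sub (memLp_const _)).integrable_sq, ?_⟩
  have hvar : ∀ m, Var[fun z => f (X m z); P] ≤ ∫ x, f x ^ 2 ∂ρ := fun m => by
    refine (variance_le_expectation_sq (hmem m).aestronglyMeasurable).trans_eq ?_
    exact (hXlaw m).integral_comp (f := fun x => f x ^ 2) (hf.pow_const 2).aestronglyMeasurable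
  have hsum : Var[∑ m, fun z => f (X m z); P] = ∑ m, Var[fun z => f (X m z); P] :=
    IndepFun.variance_sum (fun m _ => hmem m) fun m _ n _ hmn =>
      (hXindep.indepFun hmn).comp hf hf
  have hsum' : Var[fun z => ∑ m, f (X m z); P] = ∑ m, Var[fun z => f (X m z); P] := by
    rw [← hsum]; congr 1; ext z; simp
  calc ∫ z, ((M : ℝ)⁻¹ * ∑ m, f (X m z) - ∫ x, f x ∂ρ) ^ 2 ∂P
      = Var[fun z => (M : ℝ)⁻¹ * ∑ m, f (X m z); P] := by
        rw [variance_eq_integral hmemS.aemeasurable, hmean]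
    _ = (M : ℝ)⁻¹ ^ 2 * ∑ m, Var[fun z => f (X m z); P] := by
        rw [variance_const_mul, hsum']
    _ ≤ (M : ℝ)⁻¹ ^ 2 * ∑ _m : Fin M, ∫ x, f x ^ 2 ∂ρ := by
        gcongr with m _
        exact hvar m
    _ = (M : ℝ)⁻¹ * ∫ x, f x ^ 2 ∂ρ := by
        rw [Finset.sum_const, Finset.card_univ, Fintype.card_fin, nsmul_eq_mul]
        field_simp

/-! ### Gradients of ridge functions -/

/-- No regularity of `g` is needed: the derivative of an arbitrary function, with value zero where
the function is not differentiable, is Borel measurable. -/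
theorem measurable_nodalGrad (W : Matrix (Fin d) (Fin r) ℝ) (g : EuclideanSpace ℝ (Fin r) → ℝ) :
    Measurable (nodalGrad W g) := by
  have h1 : Measurable (proj W) := by
    unfold proj
    fun_prop
  have h2 : Measurable (gradient g) :=
    (LinearIsometryEquiv.continuous _).measurable.comp (measurable_fderiv ℝ g)
  exact h2.comp h1

theorem hasGradientAt_comp_proj {W : Matrix (Fin d) (Fin r) ℝ}
    {g : EuclideanSpace ℝ (Fin r) → ℝ} {x : EuclideanSpace ℝ (Fin d)}
    (hg : DifferentiableAt ℝ g (proj W x)) :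
    HasGradientAt (fun y => g (proj W y)) (WithLp.toLp 2 (W *ᵥ (nodalGrad W g x).ofLp)) x := by
  have hp : HasFDerivAt (proj W) (LinearMap.toContinuousLinearMap (Matrix.toEuclideanLin Wᵀ)) x :=
    (LinearMap.toContinuousLinearMap (Matrix.toEuclideanLin Wᵀ)).hasFDerivAt
  have h := (hasGradientAt_iff_hasFDerivAt.1 hg.hasGradientAt).comp x hp
  rw [hasGradientAt_iff_hasFDerivAt]
  refine h.congr_fderiv (ContinuousLinearMap.ext fun y => ?_)
  simp only [InnerProductSpace.toDual_apply_apply, ContinuousLinearMap.comp_apply,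
    LinearMap.coe_toContinuousLinearMap', EuclideanSpace.inner_eq_star_dotProduct, star_trivial]
  change (Wᵀ *ᵥ y.ofLp) ⬝ᵥ (nodalGrad W g x).ofLp = y.ofLp ⬝ᵥ (W *ᵥ _)
  rw [Matrix.dotProduct_mulVec, Matrix.mulVec_transpose]

theorem gradient_qoi {ω : Fin N → ℝ} {W : Fin N → Matrix (Fin d) (Fin r) ℝ}
    {g : Fin N → EuclideanSpace ℝ (Fin r) → ℝ} {x : EuclideanSpace ℝ (Fin d)}
    (hg : ∀ i, DifferentiableAt ℝ (g i) (proj (W i) x)) (a : Fin d) :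
    gradient (qoi ω W g) x a = ∑ i, ω i * (W i *ᵥ (nodalGrad (W i) (g i) x).ofLp) a := by
  have h : HasGradientAt (qoi ω W g)
      (∑ i, ω i • WithLp.toLp 2 (W i *ᵥ (nodalGrad (W i) (g i) x).ofLp)) x := by
    rw [hasGradientAt_iff_hasFDerivAt, map_sum]
    simp only [map_smul]
    exact HasFDerivAt.fun_sum fun i _ =>
      (hasGradientAt_iff_hasFDerivAt.1 (hasGradientAt_comp_proj (hg i))).const_smul (ω i)
  rw [h.gradient]
  simp

/-! ### Expansion of the gradient covariance and of its estimate -/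

/-- The sample mean `M⁻¹ ∑ₘ u(xₘ) v(xₘ)ᵀ`, the empirical counterpart of `expOuter`. It is the zero
matrix for an empty sample, `M = 0`. -/
noncomputable def empOuter {k : ℕ} (u v : EuclideanSpace ℝ (Fin d) → EuclideanSpace ℝ (Fin k))
    (xs : Fin M → EuclideanSpace ℝ (Fin d)) : Matrix (Fin k) (Fin k) ℝ :=
  (M : ℝ)⁻¹ • ∑ m, Matrix.vecMulVec (u (xs m)).ofLp (v (xs m)).ofLp

theorem gradCovEst_eq_sum (ω : Fin N → ℝ) (What W : Fin N → Matrix (Fin d) (Fin r) ℝ)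
    (g : Fin N → EuclideanSpace ℝ (Fin r) → ℝ) (xs : Fin M → EuclideanSpace ℝ (Fin d)) :
    gradCovEst ω What W g xs = ∑ i, ∑ j, (ω i * ω j) • (What i *
      empOuter (nodalGrad (W i) (g i)) (nodalGrad (W j) (g j)) xs * (What j)ᵀ) := by
  have hJ : ∀ x, jacobianEst What W g x * Matrix.vecMulVec ω ω * (jacobianEst What W g x)ᵀ =
      ∑ i, ∑ j, (ω i * ω j) • (What i * Matrix.vecMulVec (nodalGrad (W i) (g i) x).ofLp
        (nodalGrad (W j) (g j) x).ofLp * (What j)ᵀ) := fun x => by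
    ext a b
    rw [Matrix.mul_vecMulVec, Matrix.vecMulVec_mul, Matrix.vecMulVec_apply,
      Matrix.vecMul_transpose]
    simp only [Matrix.mul_vecMulVec, Matrix.vecMulVec_mul, Matrix.vecMul_transpose,
      Matrix.sum_apply, Matrix.smul_apply, Matrix.vecMulVec_apply, smul_eq_mul]
    simp only [Matrix.mulVec, dotProduct, jacobianEst, Matrix.of_apply]
    rw [Finset.sum_mul_sum]
    exact Finset.sum_congr rfl fun i _ => Finset.sum_congr rfl fun j _ => by ring
  simp only [gradCovEst, empOuter, hJ]
  rw [Finset.sum_comm, Finset.smul_sum]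
  refine Finset.sum_congr rfl fun i _ => ?_
  rw [Finset.sum_comm, Finset.smul_sum]
  refine Finset.sum_congr rfl fun j _ => ?_
  rw [Matrix.mul_smul, Matrix.smul_mul, Matrix.mul_sum, Matrix.sum_mul, ← Finset.smul_sum,
    smul_comm]

theorem gradCov_qoi_eq_sum {ρ : Measure (EuclideanSpace ℝ (Fin d))}
    (ω : Fin N → ℝ) (W : Fin N → Matrix (Fin d) (Fin r) ℝ)
    {g : Fin N → EuclideanSpace ℝ (Fin r) → ℝ}
    (hg : ∀ i, ∀ᵐ x ∂ρ, DifferentiableAt ℝ (g i) (proj (W i) x))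
    (hint : ∀ i j a b, Integrable
      (fun x => nodalGrad (W i) (g i) x a * nodalGrad (W j) (g j) x b) ρ) :
    gradCov ρ (qoi ω W g) = ∑ i, ∑ j, (ω i * ω j) • (W i *
      expOuter ρ (nodalGrad (W i) (g i)) (nodalGrad (W j) (g j)) * (W j)ᵀ) := by
  ext p q
  have hae : ∀ᵐ x ∂ρ, gradient (qoi ω W g) x p * gradient (qoi ω W g) x q =
      ∑ i, ∑ j, ∑ b, ∑ a, (ω i * ω j * W i p a * W j q b) *
        (nodalGrad (W i) (g i) x a * nodalGrad (W j) (g j) x b) := by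
    filter_upwards [ae_all_iff.2 hg] with x hx
    rw [gradient_qoi hx, gradient_qoi hx, Finset.sum_mul_sum]
    refine Finset.sum_congr rfl fun i _ => Finset.sum_congr rfl fun j _ => ?_
    rw [Finset.sum_comm]
    simp only [Matrix.mulVec, dotProduct]
    rw [mul_mul_mul_comm, Finset.sum_mul_sum, Finset.mul_sum]
    refine Finset.sum_congr rfl fun a _ => ?_
    rw [Finset.mul_sum]
    exact Finset.sum_congr rfl fun b _ => by ring
  simp only [gradCov, expOuter, Matrix.of_apply, Matrix.sum_apply, Matrix.smul_apply,
    Matrix.mul_apply, Matrix.transpose_apply, smul_eq_mul]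
  rw [integral_congr_ae hae, integral_finsetSum _ fun i _ => integrable_finsetSum _ fun j _ =>
    integrable_finsetSum _ fun b _ => integrable_finsetSum _ fun a _ => (hint i j a b).const_mul _]
  refine Finset.sum_congr rfl fun i _ => ?_
  rw [integral_finsetSum _ fun j _ =>
    integrable_finsetSum _ fun b _ => integrable_finsetSum _ fun a _ => (hint i j a b).const_mul _]
  refine Finset.sum_congr rfl fun j _ => ?_
  rw [integral_finsetSum _ fun b _ => integrable_finsetSum _ fun a _ => (hint i j a b).const_mul _,
    Finset.mul_sum]
  refine Finset.sum_congr rfl fun b _ => ?_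
  rw [integral_finsetSum _ fun a _ => (hint i j a b).const_mul _, Finset.sum_mul, Finset.mul_sum]
  refine Finset.sum_congr rfl fun a _ => ?_
  rw [integral_const_mul]
  ring

/-! ### Sampling error of outer products -/

theorem aestronglyMeasurable_norm_of_entries {m n : ℕ} {Ω : Type*} [MeasurableSpace Ω]
    {P : Measure Ω} {A : Ω → Matrix (Fin m) (Fin n) ℝ}
    (hA : ∀ a b, AEMeasurable (fun z => A z a b) P) :
    AEStronglyMeasurable (fun z => ‖A z‖) P := by
  have hc : Continuous fun f : Fin m → Fin n → ℝ => ‖(Matrix.of f : Matrix (Fin m) (Fin n) ℝ)‖ :=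
    continuous_norm.comp continuous_id
  exact (hc.measurable.comp_aemeasurable (f := fun z a b => A z a b)
    (aemeasurable_pi_lambda _ fun a => aemeasurable_pi_lambda _ fun b =>
      hA a b)).aestronglyMeasurable

theorem aemeasurable_empOuter_apply {k : ℕ} {ρ : Measure (EuclideanSpace ℝ (Fin d))}
    {u v : EuclideanSpace ℝ (Fin d) → EuclideanSpace ℝ (Fin k)}
    {Ω : Type*} [MeasurableSpace Ω] {P : Measure Ω} {X : Fin M → Ω → EuclideanSpace ℝ (Fin d)}
    (hu : Measurable u) (hv : Measurable v)
    (hXlaw : ∀ m, HasLaw (X m) ρ P) (a b : Fin k) :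
    AEMeasurable (fun z => empOuter u v (fun m => X m z) a b) P := by
  simp only [empOuter, Matrix.smul_apply, Matrix.sum_apply, Matrix.vecMulVec_apply, smul_eq_mul]
  refine (Finset.aemeasurable_fun_sum _ fun m _ => ?_).const_mul _
  have h : Measurable fun x => u x a * v x b := by fun_prop
  exact h.comp_aemeasurable (hXlaw m).aemeasurable

section Concentration

variable {k : ℕ} {ρ : Measure (EuclideanSpace ℝ (Fin d))} [IsProbabilityMeasure ρ]
  {u v : EuclideanSpace ℝ (Fin d) → EuclideanSpace ℝ (Fin k)} {L : ℝ}

theorem memLp_entry_mul_entry (hu : Measurable u) (hv : Measurable v)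
    (huL : ∀ᵐ x ∂ρ, ‖u x‖ ≤ L) (hvL : ∀ᵐ x ∂ρ, ‖v x‖ ≤ L) (a b : Fin k) :
    MemLp (fun x => u x a * v x b) 2 ρ := by
  refine MemLp.of_bound (by fun_prop) (L * L) ?_
  filter_upwards [huL, hvL] with x hx hx'
  rw [norm_mul]
  have := (norm_nonneg _).trans hx
  gcongr
  exacts [(PiLp.norm_apply_le (u x) a).trans hx, (PiLp.norm_apply_le (v x) b).trans hx']

/-- The expected squared Frobenius norm of the rank-one matrix `u vᵀ` is `E[‖u‖² ‖v‖²]`. This is why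
the bound does not depend on the dimension `k`. -/
theorem sum_integral_sq_le (hu : Measurable u) (hv : Measurable v)
    (huL : ∀ᵐ x ∂ρ, ‖u x‖ ≤ L) (hvL : ∀ᵐ x ∂ρ, ‖v x‖ ≤ L) :
    ∑ a, ∑ b, ∫ x, (u x a * v x b) ^ 2 ∂ρ ≤ (L ^ 2) ^ 2 := by
  have hi : ∀ a b, Integrable (fun x => (u x a * v x b) ^ 2) ρ := fun a b =>
    (memLp_entry_mul_entry hu hv huL hvL a b).integrable_sq
  have h : ∑ a, ∑ b, ∫ x, (u x a * v x b) ^ 2 ∂ρ = ∫ x, ∑ a, ∑ b, (u x a * v x b) ^ 2 ∂ρ := by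
    rw [integral_finsetSum _ fun a _ => integrable_finsetSum _ fun b _ => hi a b]
    exact Finset.sum_congr rfl fun a _ => (integral_finsetSum _ fun b _ => hi a b).symm
  rw [h]
  refine (integral_mono_ae (integrable_finsetSum _ fun a _ => integrable_finsetSum _ fun b _ =>
    hi a b) (integrable_const ((L ^ 2) ^ 2)) ?_).trans_eq (by simp)
  filter_upwards [huL, hvL] with x hx hx'
  have hL := (norm_nonneg _).trans hx
  simp only [mul_pow]
  rw [← Finset.sum_mul_sum, ← EuclideanSpace.real_norm_sq_eq, ← EuclideanSpace.real_norm_sq_eq,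
    sq (L ^ 2)]
  gcongr

theorem norm_expOuter_le (hu : Measurable u) (hv : Measurable v)
    (huL : ∀ᵐ x ∂ρ, ‖u x‖ ≤ L) (hvL : ∀ᵐ x ∂ρ, ‖v x‖ ≤ L) : ‖expOuter ρ u v‖ ≤ L ^ 2 := by
  refine (sq_le_sq₀ (norm_nonneg _) (by positivity)).1 ((norm_sq_le_sum_sq _).trans
    (le_trans ?_ (sum_integral_sq_le hu hv huL hvL)))
  gcongr with a _ b _
  have h := variance_eq_sub (memLp_entry_mul_entry hu hv huL hvL a b)
  have h0 := variance_nonneg (fun x => u x a * v x b) ρ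
  simp only [Pi.pow_apply] at h
  simp only [expOuter, Matrix.of_apply]
  linarith

theorem norm_empOuter_le (hL : 0 ≤ L) {xs : Fin M → EuclideanSpace ℝ (Fin d)}
    (huL : ∀ m, ‖u (xs m)‖ ≤ L) (hvL : ∀ m, ‖v (xs m)‖ ≤ L) : ‖empOuter u v xs‖ ≤ L ^ 2 := by
  have h : ‖∑ m, Matrix.vecMulVec (u (xs m)).ofLp (v (xs m)).ofLp‖ ≤ M * L ^ 2 := by
    refine (norm_sum_le_of_le _ fun m _ => (norm_vecMulVec_le _ _).trans
      (mul_le_mul (huL m) (hvL m) (norm_nonneg _) hL)).trans_eq ?_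
    simp [sq]
  rw [empOuter, norm_smul, norm_inv, Real.norm_natCast]
  refine (mul_le_mul_of_nonneg_left h (by positivity)).trans ?_
  rw [← mul_assoc]
  exact mul_le_of_le_one_left (by positivity) inv_mul_le_one

variable {Ω : Type*} [MeasurableSpace Ω] {P : Measure Ω} [IsProbabilityMeasure P]
  {X : Fin M → Ω → EuclideanSpace ℝ (Fin d)}

/-- Bound on the sampling error, with `t ≥ L² / √M`: the spectral norm is bounded by the Frobenius
norm, whose mean square is the sum of the variances of the entries. -/
theorem integral_norm_empOuter_sub_le (hu : Measurable u) (hv : Measurable v)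
    (huL : ∀ᵐ x ∂ρ, ‖u x‖ ≤ L) (hvL : ∀ᵐ x ∂ρ, ‖v x‖ ≤ L)
    (hXlaw : ∀ m, HasLaw (X m) ρ P) (hXindep : iIndepFun X P) (hM : 0 < M)
    {t : ℝ} (ht : 0 < t) (htM : (L ^ 2) ^ 2 ≤ M * t ^ 2) :
    ∫ z, ‖empOuter u v (fun m => X m z) - expOuter ρ u v‖ ∂P ≤ t := by
  set D : Ω → Matrix (Fin k) (Fin k) ℝ := fun z => empOuter u v (fun m => X m z) - expOuter ρ u v
  have hentry : ∀ a b z, D z a b =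
      (M : ℝ)⁻¹ * ∑ m, u (X m z) a * v (X m z) b - ∫ x, u x a * v x b ∂ρ := fun a b z => by
    simp [D, empOuter, expOuter, Matrix.sum_apply, Matrix.vecMulVec_apply]
  have hvar := fun a b => integral_sq_sampleMean_sub_le hXlaw hXindep hM
    (f := fun x => u x a * v x b) (by fun_prop) (memLp_entry_mul_entry hu hv huL hvL a b)
  simp only [← hentry] at hvar
  have hF : Integrable (fun z => ∑ a, ∑ b, D z a b ^ 2) P :=
    integrable_finsetSum _ fun a _ => integrable_finsetSum _ fun b _ => (hvar a b).1
  have hFint : ∫ z, ∑ a, ∑ b, D z a b ^ 2 ∂P ≤ t ^ 2 := by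
    rw [integral_finsetSum _ fun a _ => integrable_finsetSum _ fun b _ => (hvar a b).1]
    calc ∑ a, ∫ z, ∑ b, D z a b ^ 2 ∂P
        ≤ ∑ a, ∑ b, (M : ℝ)⁻¹ * ∫ x, (u x a * v x b) ^ 2 ∂ρ := by
          gcongr with a _
          rw [integral_finsetSum _ fun b _ => (hvar a b).1]
          gcongr with b _
          exact (hvar a b).2
      _ = (M : ℝ)⁻¹ * ∑ a, ∑ b, ∫ x, (u x a * v x b) ^ 2 ∂ρ := by simp only [Finset.mul_sum]
      _ ≤ (M : ℝ)⁻¹ * (M * t ^ 2) := by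
          gcongr
          exact (sum_integral_sq_le hu hv huL hvL).trans htM
      _ = t ^ 2 := by field_simp
  -- `s ≤ (s² / t + t) / 2` linearizes the square root in `E[‖D‖] ≤ √E[‖D‖²]`.
  have hpt : ∀ z, ‖D z‖ ≤ ((∑ a, ∑ b, D z a b ^ 2) / t + t) / 2 := fun z => by
    refine le_trans ?_ (div_le_div_of_nonneg_right (add_le_add_left
      (div_le_div_of_nonneg_right (norm_sq_le_sum_sq (D z)) ht.le) t) zero_le_two)
    rw [le_div_iff₀ two_pos, div_add' _ _ _ ht.ne', le_div_iff₀ ht]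
    nlinarith [sq_nonneg (‖D z‖ - t)]
  calc ∫ z, ‖D z‖ ∂P ≤ ∫ z, ((∑ a, ∑ b, D z a b ^ 2) / t + t) / 2 ∂P :=
        integral_mono_of_nonneg (.of_forall fun z => norm_nonneg _)
          (((hF.div_const t).add (integrable_const t)).div_const 2) (.of_forall hpt)
    _ = ((∫ z, ∑ a, ∑ b, D z a b ^ 2 ∂P) / t + t) / 2 := by
        rw [integral_div, integral_add (hF.div_const t) (integrable_const t), integral_div]
        simp
    _ ≤ (t ^ 2 / t + t) / 2 := by gcongr
    _ = t := by field_simp; ring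

/-- The sampling error under the sample size condition. Only `2 log (2 k) ≥ 1` and
`‖E[u vᵀ]‖ ≤ L²` are used of that condition, since they yield `M ε² ≥ 1`. If `L = 0` or `k = 0`, the
condition is void, but then `u` vanishes almost surely. -/
theorem integral_norm_empOuter_sub_le_of_log_le (hu : Measurable u) (hv : Measurable v)
    (huL : ∀ᵐ x ∂ρ, ‖u x‖ ≤ L) (hvL : ∀ᵐ x ∂ρ, ‖v x‖ ≤ L)
    (hXlaw : ∀ m, HasLaw (X m) ρ P) (hXindep : iIndepFun X P) {ε : ℝ} (hε : 0 < ε)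
    (hM : 2 * L ^ 2 * Real.log (2 * k) ≤ M * (ε ^ 2 * ‖expOuter ρ u v‖)) :
    ∫ z, ‖empOuter u v (fun m => X m z) - expOuter ρ u v‖ ∂P ≤ L ^ 2 * ε := by
  by_cases h0 : L = 0 ∨ k = 0
  · have hu0 : ∀ᵐ x ∂ρ, u x = 0 := by
      rcases h0 with rfl | rfl
      · filter_upwards [huL] with x hx using norm_le_zero_iff.1 hx
      · exact .of_forall fun x => Subsingleton.elim _ _
    have hexp : expOuter ρ u v = 0 := by
      ext a b
      refine (integral_congr_ae (g := fun _ => 0) ?_).trans (by simp)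
      filter_upwards [hu0] with x hx
      simp [hx]
    have hemp : ∀ᵐ z ∂P, ‖empOuter u v (fun m => X m z) - expOuter ρ u v‖ = 0 := by
      have hall : ∀ᵐ z ∂P, ∀ m, u (X m z) = 0 := ae_all_iff.2 fun m =>
        ae_of_ae_map (hXlaw m).aemeasurable (by rw [(hXlaw m).map_eq]; exact hu0)
      filter_upwards [hall] with z hz
      simp [empOuter, hexp, hz]
    rw [integral_congr_ae hemp, integral_zero]
    positivity
  · obtain ⟨hL, hk⟩ := not_or.1 h0
    have hL2 : 0 < L ^ 2 := by positivity
    have hk1 : (1 : ℝ) ≤ k := by exact_mod_cast Nat.one_le_iff_ne_zero.2 hk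
    have hlog : 1 ≤ 2 * Real.log (2 * k) := by
      have := Real.log_le_log two_pos (by linarith : (2 : ℝ) ≤ 2 * k)
      linarith [Real.log_two_gt_d9]
    have hMε : 1 ≤ M * ε ^ 2 := by
      refine le_of_mul_le_mul_right ?_ hL2
      calc 1 * L ^ 2 ≤ 2 * Real.log (2 * k) * L ^ 2 := by gcongr
        _ = 2 * L ^ 2 * Real.log (2 * k) := by ring
        _ ≤ M * (ε ^ 2 * ‖expOuter ρ u v‖) := hM
        _ ≤ M * (ε ^ 2 * L ^ 2) := by
            gcongr
            exact norm_expOuter_le hu hv huL hvL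
        _ = M * ε ^ 2 * L ^ 2 := by ring
    refine integral_norm_empOuter_sub_le hu hv huL hvL hXlaw hXindep ?_ (by positivity) ?_
    · refine Nat.pos_of_ne_zero fun h => ?_
      rw [h] at hMε
      norm_num at hMε
    · calc (L ^ 2) ^ 2 = 1 * (L ^ 2) ^ 2 := (one_mul _).symm
        _ ≤ M * ε ^ 2 * (L ^ 2) ^ 2 := by gcongr
        _ = M * (L ^ 2 * ε) ^ 2 := by ring

end Concentration

end EmbeddedRidge

/-! ### Mean error of the estimated gradient covariance -/

open EmbeddedRidge in
theorem theorem2p1 {d r N M : ℕ}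
    -- law of the inputs, weights, ridge bases and ridge profiles
    (ρ : Measure (EuclideanSpace ℝ (Fin d))) [IsProbabilityMeasure ρ]
    (ω : Fin N → ℝ)
    (W : Fin N → Matrix (Fin d) (Fin r) ℝ) (hW : ∀ i, (W i)ᵀ * W i = 1)
    (g : Fin N → EuclideanSpace ℝ (Fin r) → ℝ)
    (hg : ∀ i, ∀ᵐ x ∂ρ, DifferentiableAt ℝ (g i) (EmbeddedRidge.proj (W i) x))
    -- the independent sample of inputs
    {Ω : Type*} [MeasurableSpace Ω] (P : Measure Ω) [IsProbabilityMeasure P]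
    (X : Fin M → Ω → EuclideanSpace ℝ (Fin d))
    (hXlaw : ∀ m, HasLaw (X m) ρ P) (hXindep : iIndepFun X P)
    -- the estimated ridge bases, which may depend on the sample
    (What : Ω → Fin N → Matrix (Fin d) (Fin r) ℝ)
    (hWhat_meas : ∀ i a b, Measurable fun z => What z i a b)
    (hWhat_orth : ∀ i, ∀ᵐ z ∂P, (What z i)ᵀ * What z i = 1)
    (L ε η : ℝ) (hε : 0 < ε)
    (hL : ∀ i, ∀ᵐ x ∂ρ, ‖EmbeddedRidge.nodalGrad (W i) (g i) x‖ ≤ L)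
    -- `M ≥ 2 L² log (2 r) / (ε² ‖E[∇gᵢ ∇gⱼᵀ]‖)`, with the denominator cleared, so that a vanishing
    -- denominator cannot make the condition hold by convention
    (hM : ∀ i j, 2 * L ^ 2 * Real.log (2 * r) ≤
      M * (ε ^ 2 * ‖EmbeddedRidge.expOuter ρ (EmbeddedRidge.nodalGrad (W i) (g i))
        (EmbeddedRidge.nodalGrad (W j) (g j))‖))
    (hη : ∀ i, ∀ᵐ z ∂P, ‖What z i - W i‖ ≤ η) :
    Integrable (fun z => ‖EmbeddedRidge.gradCovEst ω (What z) W g (fun m => X m z) -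
        EmbeddedRidge.gradCov ρ (EmbeddedRidge.qoi ω W g)‖) P ∧
      ∫ z, ‖EmbeddedRidge.gradCovEst ω (What z) W g (fun m => X m z) -
        EmbeddedRidge.gradCov ρ (EmbeddedRidge.qoi ω W g)‖ ∂P ≤
      L ^ 2 * (∑ i, ∑ j, |ω i * ω j|) * (2 * η + ε + ε ^ 2) := by
  have hmg := fun i => measurable_nodalGrad (W i) (g i)
  set G := fun i => nodalGrad (W i) (g i)
  have hint : ∀ i j a b, Integrable (fun x => G i x a * G j x b) ρ := fun i j a b =>
    (memLp_entry_mul_entry (hmg i) (hmg j) (hL i) (hL j) a b).integrable one_le_two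
  set D := fun i j z => ‖empOuter (G i) (G j) (fun m => X m z) - expOuter ρ (G i) (G j)‖
  have hsample : ∀ᵐ z ∂P, ∀ i m, ‖G i (X m z)‖ ≤ L := ae_all_iff.2 fun i => ae_all_iff.2 fun m =>
    ae_of_ae_map (hXlaw m).aemeasurable (by rw [(hXlaw m).map_eq]; exact hL i)
  -- For `N = 0` nothing excludes `L < 0`, hence the index argument.
  have hLnn : ∀ _ : Fin N, 0 ≤ L := fun i => by
    obtain ⟨x, hx⟩ := (hL i).exists
    exact (norm_nonneg _).trans hx
  have hDint : ∀ i j, Integrable (D i j) P := fun i j => by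
    refine Integrable.of_bound (aestronglyMeasurable_norm_of_entries fun a b =>
      (aemeasurable_empOuter_apply (hmg i) (hmg j) hXlaw a b).sub_const _) (L ^ 2 + L ^ 2) ?_
    filter_upwards [hsample] with z hz
    rw [norm_norm]
    exact (norm_sub_le _ _).trans (add_le_add (norm_empOuter_le (hLnn i) (hz i) (hz j))
      (norm_expOuter_le (hmg i) (hmg j) (hL i) (hL j)))
  have hbound : ∀ᵐ z ∂P, ‖gradCovEst ω (What z) W g (fun m => X m z) - gradCov ρ (qoi ω W g)‖ ≤
      ∑ i, ∑ j, |ω i * ω j| * (2 * η * L ^ 2 + D i j z) := by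
    filter_upwards [hsample, ae_all_iff.2 hη, ae_all_iff.2 hWhat_orth] with z hz hzη hzo
    rw [gradCovEst_eq_sum, gradCov_qoi_eq_sum ω W hg hint, ← Finset.sum_sub_distrib]
    refine norm_sum_le_of_le _ fun i _ => ?_
    rw [← Finset.sum_sub_distrib]
    refine norm_sum_le_of_le _ fun j _ => ?_
    rw [← smul_sub, norm_smul, Real.norm_eq_abs]
    gcongr
    exact norm_conj_sub_conj_le _ _ (norm_le_one_of_transpose_mul_self (hW i))
      (norm_le_one_of_transpose_mul_self (hW j)) (norm_le_one_of_transpose_mul_self (hzo j))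
      (hzη i) (hzη j) (norm_empOuter_le (hLnn i) (hz i) (hz j))
  have hterm : ∀ i j, Integrable (fun z => |ω i * ω j| * (2 * η * L ^ 2 + D i j z)) P :=
    fun i j => ((integrable_const _).add (hDint i j)).const_mul _
  have hmaj : Integrable (fun z => ∑ i, ∑ j, |ω i * ω j| * (2 * η * L ^ 2 + D i j z)) P :=
    integrable_finsetSum _ fun i _ => integrable_finsetSum _ fun j _ => hterm i j
  have hmeas : AEStronglyMeasurable
      (fun z => ‖gradCovEst ω (What z) W g (fun m => X m z) - gradCov ρ (qoi ω W g)‖) P := by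
    refine aestronglyMeasurable_norm_of_entries fun a b => AEMeasurable.sub_const ?_ _
    simp only [gradCovEst_eq_sum, Matrix.sum_apply, Matrix.smul_apply, Matrix.mul_apply,
      Matrix.transpose_apply, smul_eq_mul]
    refine Finset.aemeasurable_fun_sum _ fun i _ => Finset.aemeasurable_fun_sum _ fun j _ =>
      (Finset.aemeasurable_fun_sum _ fun q _ => (Finset.aemeasurable_fun_sum _ fun p _ =>
        (hWhat_meas i a p).aemeasurable.mul ?_).mul (hWhat_meas j b q).aemeasurable).const_mul _
    exact aemeasurable_empOuter_apply (hmg i) (hmg j) hXlaw p q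
  refine ⟨hmaj.mono' hmeas (hbound.mono fun z hz => by rwa [norm_norm]), ?_⟩
  calc ∫ z, ‖gradCovEst ω (What z) W g (fun m => X m z) - gradCov ρ (qoi ω W g)‖ ∂P
      ≤ ∫ z, ∑ i, ∑ j, |ω i * ω j| * (2 * η * L ^ 2 + D i j z) ∂P :=
        integral_mono_of_nonneg (.of_forall fun z => norm_nonneg _) hmaj hbound
    _ = ∑ i, ∑ j, |ω i * ω j| * (2 * η * L ^ 2 + ∫ z, D i j z ∂P) := by
        rw [integral_finsetSum _ fun i _ => integrable_finsetSum _ fun j _ => hterm i j]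
        refine Finset.sum_congr rfl fun i _ => ?_
        rw [integral_finsetSum _ fun j _ => hterm i j]
        refine Finset.sum_congr rfl fun j _ => ?_
        rw [integral_const_mul, integral_add (integrable_const _) (hDint i j)]
        simp
    _ ≤ ∑ i, ∑ j, |ω i * ω j| * (2 * η * L ^ 2 + L ^ 2 * ε) := by
        gcongr with i _ j _
        exact integral_norm_empOuter_sub_le_of_log_le (hmg i) (hmg j) (hL i) (hL j) hXlaw
          hXindep hε (hM i j)
    _ = L ^ 2 * (∑ i, ∑ j, |ω i * ω j|) * (2 * η + ε) := by
        simp only [← Finset.sum_mul]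
        ring
    _ ≤ L ^ 2 * (∑ i, ∑ j, |ω i * ω j|) * (2 * η + ε + ε ^ 2) :=
        mul_le_mul_of_nonneg_left (le_add_of_nonneg_right (by positivity)) (by positivity)
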